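/- Let $\alpha>0$ and let $u=u(x)$ be an axially symmetric classical solution of the $Q$-curvature type equation $\alpha P_6u+120\bigl(1-\frac{e^{6u}}{\int_{\mathbb S^6}e^{6u}\,dw}\bigr)=0$ on $\mathbb S^6\subset\mathbb R^7$, where $P_6=-\Delta(-\Delta+4)(-\Delta+6)$ and $dw$ is the normalized surface measure. In other words, $u$ depends only on the coordinate $x=x_7\in[-1,1]$, it is of class $C^6$ as a function on all of $\mathbb S^6$, and it satisfies the equation written in the variable $x$, $$-\alpha\bigl[(1-x^2)^3u'\bigr]^{(5)}+120-128\,\frac{e^{6u}}{\gamma}=0,\quad x\in(-1,1),\qquad \gamma=\int_{-1}^1(1-x^2)^2e^{6u}\,dx .$$ Put $G(x)=(1-x^2)u'(x)$ and $$\lfloor G\rfloor^2=-\int_{-1}^{1}(1-x^2)^2\bigl[(1-x^2)^3G'\bigr]^{(5)}G\,dx .$$ Then all the integrals involved converge, and $$\lfloor G\rfloor^2\le-15\int_{-1}^{1}\bigl|[(1-x^2)^2G]''\bigr|^2dx+\frac{720}{\alpha}\int_{-1}^{1}(1-x^2)^2G^2\,dx+\frac{160}{\alpha}\int_{-1}^{1}(1-x^2)^3(G')^2\,dx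 .$$ -/

import Mathlib

open MeasureTheory Metric
open scoped Manifold ContDiff

noncomputable section

/-- The dimension of the ambient space of the sphere `𝕊⁶`. -/
instance instFactFinrankR7 : Fact (Module.finrank ℝ (EuclideanSpace ℝ (Fin 7)) = 6 + 1) :=
  ⟨by simp⟩

/-- The unit sphere `𝕊⁶` of `ℝ⁷`, with Mathlib's manifold structure. -/
abbrev Sphere6 : Type := sphere (0 : EuclideanSpace ℝ (Fin 7)) 1

/-- The axially symmetric function on `𝕊⁶` with profile `u`: its value at `p` is `u x`, where
`x ∈ [-1, 1]` is the last coordinate of `p`. -/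
def axialLift (u : ℝ → ℝ) (p : Sphere6) : ℝ := u ((p : EuclideanSpace ℝ (Fin 7)) 6)

/-- `γ = ∫_{-1}^{1} (1 - x²)² e^{6u} dx`. -/
def gammaConst (u : ℝ → ℝ) : ℝ :=
  ∫ x in (-1 : ℝ)..1, (1 - x ^ 2) ^ 2 * Real.exp (6 * u x)

/-- `u` is the profile of an axially symmetric classical solution of the `Q`-curvature type equation
`α P₆ u + 120 (1 - e^{6u} / ∫ e^{6u}) = 0` on `𝕊⁶`: the function is of class `C⁶` on all of `𝕊⁶`
(poles included), and the equation, written in the variable `x`, holds on `(-1, 1)`. -/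
structure IsAxialSolution (α : ℝ) (u : ℝ → ℝ) : Prop where
  contMDiff : ContMDiff (𝓡 6) 𝓘(ℝ, ℝ) 6 (axialLift u)
  equation : ∀ x ∈ Set.Ioo (-1 : ℝ) 1,
    -α * iteratedDeriv 5 (fun y : ℝ => (1 - y ^ 2) ^ 3 * deriv u y) x + 120
      - 128 * Real.exp (6 * u x) / gammaConst u = 0

/-- `G(x) = (1 - x²) u'(x)`. -/
def axialG (u : ℝ → ℝ) (x : ℝ) : ℝ := (1 - x ^ 2) * deriv u x

/-- The integrand `(1 - x²)² [(1 - x²)³ G']⁽⁵⁾ G`. -/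
def floorIntegrand (G : ℝ → ℝ) (x : ℝ) : ℝ :=
  (1 - x ^ 2) ^ 2 * iteratedDeriv 5 (fun y : ℝ => (1 - y ^ 2) ^ 3 * deriv G y) x * G x

/-- The squared semi-norm `⌊G⌋² = -∫_{-1}^{1} (1 - x²)² [(1 - x²)³ G']⁽⁵⁾ G dx`. -/
def floorSq (G : ℝ → ℝ) : ℝ := -∫ x in (-1 : ℝ)..1, floorIntegrand G x

end

/-!
Write `p = 1 - x²`, `G = p u'` and `g = p² G = p³ u'`, so that the equation reads
`α g⁽⁵⁾ = 120 - 128 e^{6u} / γ` on `(-1, 1)`.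

*Regularity.* In the angle `θ`, with `x = cos θ`, the profile is of class `C⁶` on the whole line,
which makes `u` continuous on `[-1, 1]` and `p u'²` bounded. The equation then bootstraps: if `u` is
`C^k` up to the poles, then `g` is `C^{k+5}`; as `g² = O(p⁵)`, it vanishes to third order at `±1`,
and dividing by `p³` (Hadamard's lemma) shows that `u'` is `C^{k+2}`. Hence `u` agrees on `[-1, 1]`
with a function that is as smooth as needed on `ℝ`
(`exists_contDiff_add_three_extension`, `IsAxialSolution.exists_contDiff_extension`). All integrals
converge for that reason, and every integration by parts below is legitimate.

*The identity.* Differentiating the equation once gives `α p g⁽⁶⁾ = 6 G (α g⁽⁵⁾ - 120)`, and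
`[p³ G']⁽⁵⁾ = p g⁽⁶⁾ - 6 x g⁽⁵⁾`. Therefore
`⌊G⌋² = (720 / α) ∫ p² G² + 6 ∫ x g g⁽⁵⁾ - 6 ∫ G g g⁽⁵⁾`. Integration by parts turns the second term
into `-15 ∫ g''²` and the third into `-15 ∫ p³ G'² M` with `M = p G''' - 8 x G'' - (32/3) G'`
(`hasDerivAt_quadratic_boundary_term`, `hasDerivAt_cubic_boundary_term`); the boundary terms vanish
because `G(±1) = 0`.

*The pointwise bound.* It remains to see that `-α M ≤ 32/3`. For `b = 10` and `b = 12` the function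
`M_b = p G''' - 8 x G'' - b G'` satisfies
`p M_b'' - 8 x M_b' - (22 - b) M_b = g⁽⁵⁾ ≤ 120 / α`, so that the minimum principle for this operator
(`neg_le_of_degenerate_elliptic_le`) gives `-α M₁₀ ≤ 10` and `-α M₁₂ ≤ 12`. Since
`M = (2/3) M₁₀ + (1/3) M₁₂`, the bound follows.
-/

open Set Filter Topology

/-! ### Division by powers of `x - a` and primitives of `C^n` functions -/

theorem hasDerivAt_integral_mul_comp_homothety {φ h : ℝ → ℝ} (a : ℝ) (hφ : Continuous φ)
    (hh : ContDiff ℝ 1 h) (x : ℝ) :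
    HasDerivAt (fun x => ∫ t in (0 : ℝ)..1, φ t * h (a + t * (x - a)))
      (∫ t in (0 : ℝ)..1, φ t * t * deriv h (a + t * (x - a))) x := by
  have hd : Continuous (deriv h) := hh.continuous_deriv le_rfl
  have hc : Continuous h := hh.continuous
  obtain ⟨C, hC⟩ := ((isCompact_Icc (a := (0 : ℝ)) (b := 1)).prod
    (isCompact_closedBall x 1)).exists_bound_of_continuousOn
      (f := fun q : ℝ × ℝ => φ q.1 * q.1 * deriv h (a + q.1 * (q.2 - a)))
      (by fun_prop)
  refine (intervalIntegral.hasDerivAt_integral_of_dominated_loc_of_deriv_le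
    (F := fun x t => φ t * h (a + t * (x - a)))
    (F' := fun x t => φ t * t * deriv h (a + t * (x - a)))
    (bound := fun _ => C) (ball_mem_nhds x one_pos) ?_ ?_ ?_ ?_ ?_ ?_).2
  · exact Eventually.of_forall fun y =>
      Continuous.aestronglyMeasurable (by fun_prop)
  · exact Continuous.intervalIntegrable (by fun_prop) _ _
  · exact Continuous.aestronglyMeasurable (by fun_prop)
  · refine Eventually.of_forall fun t ht y hy => hC (t, y) ⟨?_, ball_subset_closedBall hy⟩
    rw [uIoc_of_le zero_le_one] at ht
    exact ⟨ht.1.le, ht.2⟩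
  · exact intervalIntegrable_const
  · refine Eventually.of_forall fun t _ y _ => ?_
    have h1 : HasDerivAt (fun y => a + t * (y - a)) t y := by
      simpa using (((hasDerivAt_id y).sub_const a).const_mul t).const_add a
    have h2 := ((hh.differentiable one_ne_zero).differentiableAt.hasDerivAt).comp y h1
    simpa [mul_comm, mul_assoc, mul_left_comm] using h2.const_mul (φ t)

theorem contDiff_integral_mul_comp_homothety (a : ℝ) (n : ℕ) {φ h : ℝ → ℝ} (hφ : Continuous φ)
    (hh : ContDiff ℝ n h) :
    ContDiff ℝ n (fun x => ∫ t in (0 : ℝ)..1, φ t * h (a + t * (x - a))) := by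
  induction n generalizing φ h with
  | zero =>
    have hc : Continuous h := hh.continuous
    refine contDiff_zero.2 ?_
    exact intervalIntegral.continuous_parametric_intervalIntegral_of_continuous'
      (by fun_prop) 0 1
  | succ n ih =>
    have h1 : ContDiff ℝ 1 h := hh.of_le (by exact_mod_cast Nat.succ_le_succ (Nat.zero_le n))
    have hd := hasDerivAt_integral_mul_comp_homothety a hφ h1
    push_cast at hh ⊢
    refine contDiff_succ_iff_deriv.2 ⟨fun x => (hd x).differentiableAt, by simp, ?_⟩
    rw [show deriv _ = _ from funext fun x => (hd x).deriv]
    exact ih (hφ.mul continuous_id) (contDiff_succ_iff_deriv.1 hh).2.2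

/-- Hadamard's lemma on the real line: a function of class `C^{n+1}` vanishing at `a` is
`x - a` times a function of class `C^n`. -/
theorem exists_contDiff_eq_sub_mul {f : ℝ → ℝ} {a : ℝ} {n : ℕ} (hf : ContDiff ℝ (n + 1 : ℕ) f)
    (ha : f a = 0) : ∃ g : ℝ → ℝ, ContDiff ℝ n g ∧ ∀ x, f x = (x - a) * g x := by
  push_cast at hf
  have hf' := contDiff_succ_iff_deriv.1 hf
  refine ⟨fun x => ∫ t in (0 : ℝ)..1, 1 * deriv f (a + t * (x - a)),
    contDiff_integral_mul_comp_homothety a n continuous_const hf'.2.2, fun x => ?_⟩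
  have h : ∀ t ∈ uIcc (0 : ℝ) 1, HasDerivAt (fun t => f (a + t * (x - a)))
      ((x - a) * deriv f (a + t * (x - a))) t := fun t _ => by
    have h1 : HasDerivAt (fun t => a + t * (x - a)) (x - a) t := by
      simpa using ((hasDerivAt_id t).mul_const (x - a)).const_add a
    exact ((hf'.1 _).hasDerivAt.comp t h1).congr_deriv (mul_comm _ _)
  have hc : Continuous (deriv f) := hf'.2.2.continuous
  have := intervalIntegral.integral_eq_sub_of_hasDerivAt h
    (Continuous.intervalIntegrable (by fun_prop) _ _)
  simp only [one_mul, zero_mul, add_zero, ha, sub_zero, add_sub_cancel,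
    intervalIntegral.integral_const_mul] at this ⊢
  exact this.symm

/-- If `f` is of class `C^{n+m}` and `f = O(|x - a|^{m - 1/2})` on a set accumulating at `a`, then
`f` is `(x - a)^m` times a function of class `C^n`. The growth hypothesis is stated for `f²`, to
keep the exponents integral. -/
theorem exists_contDiff_eq_sub_pow_mul {a C : ℝ} {s : Set ℝ} (has : a ∉ s) (hs : a ∈ closure s)
    {n : ℕ} (m : ℕ) {f : ℝ → ℝ} (hf : ContDiff ℝ (n + m : ℕ) f)
    (hb : ∀ x ∈ s, |x - a| * f x ^ 2 ≤ C * |x - a| ^ (2 * m)) :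
    ∃ g : ℝ → ℝ, ContDiff ℝ n g ∧ ∀ x, f x = (x - a) ^ m * g x := by
  induction m generalizing f with
  | zero => exact ⟨f, hf, fun x => by simp⟩
  | succ m ih =>
    have hpos : ∀ x ∈ s, 0 < |x - a| := fun x hx =>
      abs_pos.2 (sub_ne_zero.2 fun h => has (h ▸ hx))
    have hfa : f a = 0 := by
      have hc : Continuous f := hf.continuous
      have hle : ∀ x ∈ s, f x ^ 2 ≤ C * |x - a| ^ (2 * m + 1) := fun x hx => by
        have := hb x hx
        rw [show 2 * (m + 1) = (2 * m + 1) + 1 by ring, pow_succ _ (2 * m + 1)] at this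
        exact le_of_mul_le_mul_left (by linarith) (hpos x hx)
      have := le_on_closure (f := fun x => f x ^ 2) (g := fun x => C * |x - a| ^ (2 * m + 1))
        hle (by fun_prop) (by fun_prop) hs
      simp only [sub_self, abs_zero, ne_eq, Nat.add_eq_zero_iff, one_ne_zero, and_false,
        not_false_eq_true, zero_pow, mul_zero] at this
      exact pow_eq_zero_iff two_ne_zero |>.1 (le_antisymm this (sq_nonneg _))
    obtain ⟨g, hg, hfg⟩ := exists_contDiff_eq_sub_mul (n := n + m) hf hfa
    obtain ⟨k, hk, hgk⟩ := ih hg fun x hx => by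
      have := hb x hx
      rw [hfg, mul_pow, ← sq_abs (x - a), show 2 * (m + 1) = 2 * m + 2 by ring, pow_add] at this
      exact le_of_mul_le_mul_left (by linarith) (pow_pos (hpos x hx) 2)
    exact ⟨k, hk, fun x => by rw [hfg, hgk]; ring⟩

theorem contDiff_integral_of_contDiff {f : ℝ → ℝ} {n : ℕ} (hf : ContDiff ℝ n f) (a c : ℝ) :
    ContDiff ℝ (n + 1 : ℕ) (fun x => c + ∫ t in a..x, f t) ∧
      ∀ x, HasDerivAt (fun x => c + ∫ t in a..x, f t) (f x) x := by
  have hd : ∀ x, HasDerivAt (fun x => c + ∫ t in a..x, f t) (f x) x := fun x =>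
    (hf.continuous.integral_hasStrictDerivAt a x).hasDerivAt.const_add c
  refine ⟨?_, hd⟩
  push_cast
  refine contDiff_succ_iff_deriv.2 ⟨fun x => (hd x).differentiableAt, by simp, ?_⟩
  rwa [show deriv _ = _ from funext fun x => (hd x).deriv]

/-- If the `m`-th derivative of `f` on an interval extends to a `C^n` function on the line,
then `f` itself extends to a `C^{n+m}` function. -/
theorem exists_contDiff_eqOn_of_iteratedDeriv_eqOn {s : Set ℝ} (hs : IsOpen s)
    (hs' : IsPreconnected s) {c : ℝ} (hc : c ∈ s) {n : ℕ} {r : ℝ → ℝ} (hr : ContDiff ℝ n r)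
    (m : ℕ) {f : ℝ → ℝ} (hf : ContDiffOn ℝ m f s) (hfr : EqOn (iteratedDeriv m f) r s) :
    ∃ e : ℝ → ℝ, ContDiff ℝ (n + m : ℕ) e ∧ EqOn e f s := by
  induction m generalizing f with
  | zero => exact ⟨r, hr, fun x hx => by simpa using (hfr hx).symm⟩
  | succ m ih =>
    push_cast at hf
    have hf' := (contDiffOn_succ_iff_deriv_of_isOpen hs).1 hf
    obtain ⟨e, he, hef⟩ := ih hf'.2.2 (by rwa [iteratedDeriv_succ'] at hfr)
    obtain ⟨h1, h2⟩ := contDiff_integral_of_contDiff he c (f c)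
    refine ⟨_, h1, hs.eqOn_of_deriv_eq hs' (fun x _ => (h2 x).differentiableAt.differentiableWithinAt)
      hf'.1 (fun x hx => ?_) hc (by simp)⟩
    rw [(h2 x).deriv, hef hx]

/-! ### Regularity of axially symmetric solutions up to the poles -/

theorem contDiff_comp_cos_of_axialLift {u : ℝ → ℝ}
    (hu : ContMDiff (𝓡 6) 𝓘(ℝ, ℝ) 6 (axialLift u)) :
    ContDiff ℝ 6 (fun θ => u (Real.cos θ)) := by
  let c : ℝ → EuclideanSpace ℝ (Fin 7) := fun θ =>
    Real.cos θ • EuclideanSpace.single 6 1 + Real.sin θ • EuclideanSpace.single 0 1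
  have hc : ContDiff ℝ 6 c := by
    have h1 : ContDiff ℝ 6 Real.cos := Real.contDiff_cos
    have h2 : ContDiff ℝ 6 Real.sin := Real.contDiff_sin
    exact (h1.smul contDiff_const).add (h2.smul contDiff_const)
  have hs : ∀ θ, c θ ∈ sphere (0 : EuclideanSpace ℝ (Fin 7)) 1 := fun θ => by
    rw [mem_sphere_zero_iff_norm, EuclideanSpace.norm_eq, Real.sqrt_eq_one]
    simp [c, Fin.sum_univ_succ]
  have h := hu.comp (hc.contMDiff.codRestrict_sphere hs)
  have he : (fun θ => u (Real.cos θ)) = axialLift u ∘ codRestrict c _ hs := by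
    funext θ
    simp [axialLift, c]
  rw [he]
  exact contMDiff_iff_contDiff.1 h

section Profile

variable {u : ℝ → ℝ}

theorem eq_comp_cos_arccos {x : ℝ} (hx : x ∈ Icc (-1 : ℝ) 1) :
    u (Real.cos (Real.arccos x)) = u x := by
  rw [Real.cos_arccos hx.1 hx.2]

theorem contDiffOn_Ioo_of_comp_cos (hV : ContDiff ℝ 6 (fun θ => u (Real.cos θ))) :
    ContDiffOn ℝ 6 u (Ioo (-1) 1) := fun x hx => by
  have h := (hV.contDiffAt (x := Real.arccos x)).comp x
    (Real.contDiffAt_arccos hx.1.ne' hx.2.ne)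
  refine (h.congr_of_eventuallyEq ?_).contDiffWithinAt
  filter_upwards [Ioo_mem_nhds hx.1 hx.2] with y hy
  exact (eq_comp_cos_arccos (Ioo_subset_Icc_self hy)).symm

/-- The derivative of the profile along a great circle is `-√(1 - x²) u'(x)`, so the latter is
bounded. -/
theorem exists_one_sub_sq_mul_deriv_sq_le (hV : ContDiff ℝ 6 (fun θ => u (Real.cos θ))) :
    ∃ C, ∀ x ∈ Ioo (-1 : ℝ) 1, (1 - x ^ 2) * deriv u x ^ 2 ≤ C := by
  have hc : Continuous (deriv fun θ => u (Real.cos θ)) := hV.continuous_deriv (by norm_num)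
  obtain ⟨C, hC⟩ := (isCompact_Icc (a := 0) (b := Real.pi)).exists_bound_of_continuousOn
    hc.continuousOn
  refine ⟨C ^ 2, fun x hx => ?_⟩
  have hx' := Real.cos_arccos hx.1.le hx.2.le
  have hd : DifferentiableAt ℝ u (Real.cos (Real.arccos x)) := by
    rw [hx']
    exact ((contDiffOn_Ioo_of_comp_cos hV).differentiableOn (by norm_num)).differentiableAt
      (Ioo_mem_nhds hx.1 hx.2)
  have h := (hd.hasDerivAt.comp _ (Real.hasDerivAt_cos (Real.arccos x))).deriv
  have hb := hC _ ⟨Real.arccos_nonneg x, Real.arccos_le_pi x⟩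
  rw [show (fun θ => u (Real.cos θ)) = u ∘ Real.cos from rfl, h, hx', Real.norm_eq_abs] at hb
  have h2 := pow_le_pow_left₀ (abs_nonneg _) hb 2
  rw [sq_abs, mul_pow, neg_sq, Real.sin_sq, hx'] at h2
  linarith

/-- One step of the regularity bootstrap: with `E = (1 - x²)³ u'`, a `C^k` right-hand side for
`E⁽⁵⁾` makes `E` of class `C^{k+5}`; since `E` vanishes to third order at both poles, `u'` is of
class `C^{k+2}` up to the poles. -/
theorem exists_contDiff_add_three_extension (hu : ContDiffOn ℝ 6 u (Ioo (-1) 1))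
    {C : ℝ} (hC : ∀ x ∈ Ioo (-1 : ℝ) 1, (1 - x ^ 2) * deriv u x ^ 2 ≤ C) {a b : ℝ}
    (heq : ∀ x ∈ Ioo (-1 : ℝ) 1, iteratedDeriv 5 (fun y : ℝ => (1 - y ^ 2) ^ 3 * deriv u y) x =
      a + b * Real.exp (6 * u x))
    {k : ℕ} {w : ℝ → ℝ} (hw : ContDiff ℝ k w) (hwu : EqOn w u (Icc (-1) 1)) :
    ∃ w' : ℝ → ℝ, ContDiff ℝ (k + 3 : ℕ) w' ∧ EqOn w' u (Icc (-1) 1) := by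
  have h0 : (0 : ℝ) ∈ Ioo (-1 : ℝ) 1 := by norm_num
  have hC0 : 0 ≤ C := le_trans (by norm_num; positivity) (hC 0 h0)
  have hsub : Ioo (-1 : ℝ) 1 ⊆ Icc (-1) 1 := Ioo_subset_Icc_self
  have hcl : closure (Ioo (-1 : ℝ) 1) = Icc (-1) 1 := closure_Ioo (by norm_num)
  have hu' := (contDiffOn_succ_iff_deriv_of_isOpen (n := 5) isOpen_Ioo).1 hu
  have hr : ContDiff ℝ k fun x => a + b * Real.exp (6 * w x) := by fun_prop
  obtain ⟨E, hE, hEF⟩ := exists_contDiff_eqOn_of_iteratedDeriv_eqOn isOpen_Ioo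
    isPreconnected_Ioo h0 hr 5 (f := fun y : ℝ => (1 - y ^ 2) ^ 3 * deriv u y)
    (ContDiffOn.mul (by fun_prop) hu'.2.2) fun x hx => by rw [heq x hx, hwu (hsub hx)]
  have hE2 : ∀ x ∈ Ioo (-1 : ℝ) 1, E x ^ 2 ≤ C * (1 - x) ^ 5 * (1 + x) ^ 5 := fun x hx => by
    have hp : 0 ≤ 1 - x ^ 2 := by nlinarith [hx.1, hx.2]
    calc E x ^ 2 = (1 - x ^ 2) ^ 5 * ((1 - x ^ 2) * deriv u x ^ 2) := by rw [hEF hx]; ring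
      _ ≤ (1 - x ^ 2) ^ 5 * C := by gcongr; exact hC x hx
      _ = _ := by ring
  obtain ⟨A, hA, hEA⟩ := exists_contDiff_eq_sub_pow_mul (a := 1) (C := C * 32) (n := k + 2)
    (s := Ioo (-1 : ℝ) 1) (by simp) (by rw [hcl]; norm_num) 3 hE fun x hx => by
      rw [abs_sub_comm, abs_of_pos (by linarith [hx.2])]
      have h1 : 0 ≤ 1 - x := by linarith [hx.2]
      have h2 : 0 ≤ 1 + x := by linarith [hx.1]
      have h3 : (1 + x) ^ 5 ≤ 2 ^ 5 := pow_le_pow_left₀ h2 (by linarith [hx.2]) 5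
      calc (1 - x) * E x ^ 2 ≤ (1 - x) * (C * (1 - x) ^ 5 * 2 ^ 5) :=
            mul_le_mul_of_nonneg_left ((hE2 x hx).trans (by gcongr)) h1
        _ = _ := by ring
  obtain ⟨B, hB, hEB⟩ := exists_contDiff_eq_sub_pow_mul (a := -1) (C := C * 32) (n := k + 2)
    (s := Ioo (-1 : ℝ) 1) (by simp) (by rw [hcl]; norm_num) 3 hE fun x hx => by
      rw [sub_neg_eq_add, add_comm x 1, abs_of_pos (by linarith [hx.1])]
      have h1 : 0 ≤ 1 - x := by linarith [hx.2]
      have h2 : 0 ≤ 1 + x := by linarith [hx.1]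
      have h3 : (1 - x) ^ 5 ≤ 2 ^ 5 := pow_le_pow_left₀ h1 (by linarith [hx.1]) 5
      calc (1 + x) * E x ^ 2 ≤ (1 + x) * (C * 2 ^ 5 * (1 + x) ^ 5) :=
            mul_le_mul_of_nonneg_left ((hE2 x hx).trans (by gcongr)) h2
        _ = _ := by ring
  -- Partial fractions of `(1 - x²)⁻³`: dividing by `(x - 1)³` and `(x + 1)³` one after the other
  -- would cost six derivatives instead of three.
  let H : ℝ → ℝ := fun x =>
    -(1 / 32) * (((x + 1) ^ 2 - 5 * (x + 1) * (x - 1) + 10 * (x - 1) ^ 2) * A x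
      + (-10 * (x + 1) ^ 2 + 5 * (x + 1) * (x - 1) - (x - 1) ^ 2) * B x)
  have hH : ContDiff ℝ (k + 2 : ℕ) H := by fun_prop
  have hHu : EqOn H (deriv u) (Ioo (-1) 1) := fun x hx => by
    have h1 : x - 1 ≠ 0 := by linarith [hx.2]
    have h2 : x + 1 ≠ 0 := by linarith [hx.1]
    have hA' : A x = E x / (x - 1) ^ 3 := by rw [hEA x]; field_simp
    have hB' : B x = E x / (x + 1) ^ 3 := by
      rw [hEB x, sub_neg_eq_add]; field_simp
    simp only [H, hA', hB', hEF hx]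
    field_simp
    ring
  obtain ⟨h1, h2⟩ := contDiff_integral_of_contDiff hH 0 (u 0)
  refine ⟨_, h1, ?_⟩
  have hIoo : EqOn (fun x => u 0 + ∫ t in (0 : ℝ)..x, H t) u (Ioo (-1) 1) :=
    isOpen_Ioo.eqOn_of_deriv_eq isPreconnected_Ioo
      (fun x _ => (h2 x).differentiableAt.differentiableWithinAt) hu'.1
      (fun x hx => by rw [(h2 x).deriv, hHu hx]) h0 (by simp)
  have hw' : EqOn (fun x => u 0 + ∫ t in (0 : ℝ)..x, H t) w (closure (Ioo (-1) 1)) :=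
    (hIoo.trans (hwu.mono hsub).symm).closure h1.continuous hw.continuous
  rw [hcl] at hw'
  exact fun x hx => (hw' hx).trans (hwu hx)

theorem IsAxialSolution.iteratedDeriv_five_eq {α : ℝ} (hα : 0 < α) (hu : IsAxialSolution α u)
    {x : ℝ} (hx : x ∈ Ioo (-1 : ℝ) 1) :
    iteratedDeriv 5 (fun y : ℝ => (1 - y ^ 2) ^ 3 * deriv u y) x =
      120 / α + -128 / (gammaConst u * α) * Real.exp (6 * u x) := by
  have h := hu.equation x hx
  rw [← mul_right_inj' hα.ne']
  calc _ = 120 - 128 * Real.exp (6 * u x) / gammaConst u := by linarith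
    _ = α / α * (120 - 128 * Real.exp (6 * u x) / gammaConst u) := by
      rw [div_self hα.ne', one_mul]
    _ = _ := by rw [div_mul_eq_div_div (-128 : ℝ)]; ring

/-- A solution is smooth up to the poles as a function of `x`. Nine derivatives are enough here. -/
theorem IsAxialSolution.exists_contDiff_extension {α : ℝ} (hα : 0 < α)
    (hu : IsAxialSolution α u) :
    ∃ w : ℝ → ℝ, ContDiff ℝ 9 w ∧ EqOn w u (Icc (-1) 1) := by
  have hV := contDiff_comp_cos_of_axialLift hu.contMDiff
  have hu6 := contDiffOn_Ioo_of_comp_cos hV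
  obtain ⟨C, hC⟩ := exists_one_sub_sq_mul_deriv_sq_le hV
  have heq := fun x hx => hu.iteratedDeriv_five_eq hα (x := x) hx
  have h0 : ContDiff ℝ (0 : ℕ) fun x => u (Real.cos (Real.arccos x)) :=
    contDiff_zero.2 (hV.continuous.comp Real.continuous_arccos)
  obtain ⟨w₁, h1, e1⟩ := exists_contDiff_add_three_extension hu6 hC heq h0
    fun x hx => eq_comp_cos_arccos hx
  obtain ⟨w₂, h2, e2⟩ := exists_contDiff_add_three_extension hu6 hC heq h1 e1
  obtain ⟨w₃, h3, e3⟩ := exists_contDiff_add_three_extension hu6 hC heq h2 e2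
  exact ⟨w₃, h3, e3⟩

end Profile

/-! ### The minimum principle and the boundary terms -/

theorem IsLocalMin.second_deriv_nonneg {f f' : ℝ → ℝ} {x₀ f'' : ℝ} (h : IsLocalMin f x₀)
    (hf : ∀ x, HasDerivAt f (f' x) x) (hf' : HasDerivAt f' f'' x₀) : 0 ≤ f'' := by
  by_contra! hneg
  have hd : deriv f = f' := funext fun x => (hf x).deriv
  have hmax : IsLocalMax f x₀ := isLocalMax_of_deriv_deriv_neg (by rwa [hd, hf'.deriv])
    h.deriv_eq_zero (hf x₀).continuousAt
  -- A local minimum that is also a local maximum forces `f` to be locally constant.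
  have hconst : f =ᶠ[𝓝 x₀] fun _ => f x₀ := by
    filter_upwards [h, hmax] with x h1 h2 using le_antisymm h2 h1
  have h2 := hconst.deriv.deriv_eq
  rw [hd, hf'.deriv] at h2
  simp at h2
  exact hneg.ne h2

/-- Minimum principle for the Legendre-type operator `(1 - x²) ∂² - 8 x ∂ - d`, `d > 0`, on
`[-1, 1]`. No boundary condition is needed, as the operator degenerates at `±1`. -/
theorem neg_le_of_degenerate_elliptic_le {M M₁ M₂ : ℝ → ℝ} (h₁ : ∀ x, HasDerivAt M (M₁ x) x)
    (h₂ : ∀ x, HasDerivAt M₁ (M₂ x) x) {d K : ℝ} (hd : 0 < d)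
    (hK : ∀ x ∈ Icc (-1 : ℝ) 1, (1 - x ^ 2) * M₂ x - 8 * x * M₁ x - d * M x ≤ K)
    {x : ℝ} (hx : x ∈ Icc (-1 : ℝ) 1) : d * -M x ≤ K := by
  have hc : Continuous M := continuous_iff_continuousAt.2 fun x => (h₁ x).continuousAt
  obtain ⟨y, hy, hmin⟩ := isCompact_Icc.exists_isMinOn ⟨x, hx⟩ hc.continuousOn
  have hsin : Real.sin (Real.arcsin y) = y := Real.sin_arcsin hy.1 hy.2
  -- The substitution `x = sin θ` turns a minimum over `[-1, 1]`, even at an end point, into a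
  -- minimum over the whole line.
  have hN : ∀ θ, HasDerivAt (fun θ => M (Real.sin θ)) (M₁ (Real.sin θ) * Real.cos θ) θ :=
    fun θ => (h₁ _).comp θ (Real.hasDerivAt_sin θ)
  have hN' : HasDerivAt (fun θ => M₁ (Real.sin θ) * Real.cos θ)
      ((1 - y ^ 2) * M₂ y - y * M₁ y) (Real.arcsin y) := by
    refine (((h₂ _).comp _ (Real.hasDerivAt_sin _)).mul (Real.hasDerivAt_cos _)).congr_deriv ?_
    have := Real.cos_sq' (Real.arcsin y)
    simp only [Function.comp, hsin] at this ⊢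
    rw [← this]
    ring
  have hNmin : IsLocalMin (fun θ => M (Real.sin θ)) (Real.arcsin y) :=
    Eventually.of_forall fun θ => by
      simp only [hsin]
      exact hmin ⟨Real.neg_one_le_sin θ, Real.sin_le_one θ⟩
  have hcrit := hNmin.hasDerivAt_eq_zero (hN _)
  have hsecond := hNmin.second_deriv_nonneg hN hN'
  have hnonneg : 0 ≤ (1 - y ^ 2) * M₂ y - 8 * y * M₁ y := by
    rw [hsin] at hcrit
    rcases mul_eq_zero.1 hcrit with h | h
    · rw [h] at hsecond ⊢
      linarith
    · have hy2 := Real.cos_sq' (Real.arcsin y)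
      rw [h, hsin] at hy2
      have : 1 - y ^ 2 = 0 := by linarith
      rw [this] at hsecond ⊢
      linarith
  have hxy : M y ≤ M x := hmin hx
  have := hK y hy
  nlinarith

theorem ContDiff.hasDerivAt_iteratedDeriv {f : ℝ → ℝ} {n k : ℕ} (hf : ContDiff ℝ n f)
    (hk : k < n) (x : ℝ) : HasDerivAt (iteratedDeriv k f) (iteratedDeriv (k + 1) f x) x := by
  rw [iteratedDeriv_succ]
  exact ((hf.differentiable_iteratedDeriv k (by exact_mod_cast hk)) x).hasDerivAt

theorem hasDerivAt_one_sub_sq (x : ℝ) : HasDerivAt (fun y : ℝ => 1 - y ^ 2) (-2 * x) x := by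
  simpa using ((hasDerivAt_id x).pow 2).const_sub 1

/-- The cubic form `∫ (1 - x²)² G² [(1 - x²)² G]⁽⁵⁾` equals
`(5/2) ∫ (1 - x²)³ G'² ((1 - x²) G''' - 8 x G'' - (32/3) G')` up to a boundary term, given here in
closed form; `G₀, …, G₅` are `G` and its derivatives. -/
theorem hasDerivAt_cubic_boundary_term {G₀ G₁ G₂ G₃ G₄ : ℝ → ℝ} {G₅ : ℝ} (x : ℝ)
    (h₀ : HasDerivAt G₀ (G₁ x) x) (h₁ : HasDerivAt G₁ (G₂ x) x) (h₂ : HasDerivAt G₂ (G₃ x) x)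
    (h₃ : HasDerivAt G₃ (G₄ x) x) (h₄ : HasDerivAt G₄ G₅ x) :
    HasDerivAt (fun y =>
      (1 - y ^ 2) ^ 4 * (G₀ y ^ 2 * G₄ y - 2 * (G₀ y * (G₁ y * G₃ y)) + G₀ y * G₂ y ^ 2
        - 1 / 2 * (G₁ y ^ 2 * G₂ y))
      + y * (1 - y ^ 2) ^ 3 * (-12 * (G₀ y ^ 2 * G₃ y) + 8 * (G₀ y * (G₁ y * G₂ y))
        + 8 / 3 * G₁ y ^ 3)
      + (1 - y ^ 2) ^ 2 * ((36 * y ^ 2 - 28) * (G₀ y ^ 2 * G₂ y)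
        + (24 - 8 * y ^ 2) * (G₀ y * G₁ y ^ 2))
      + (1 - y ^ 2) * (56 * y - 24 * y ^ 3) * (G₀ y ^ 2 * G₁ y) + 64 / 3 * G₀ y ^ 3)
    ((1 - x ^ 2) ^ 2 * G₀ x ^ 2 * ((1 - x ^ 2) ^ 2 * G₅ - 20 * x * (1 - x ^ 2) * G₄ x
        + 40 * (3 * x ^ 2 - 1) * G₃ x + 240 * x * G₂ x + 120 * G₁ x)
      - 5 / 2 * ((1 - x ^ 2) ^ 3 * G₁ x ^ 2 *
        ((1 - x ^ 2) * G₃ x - 8 * x * G₂ x - 32 / 3 * G₁ x))) x := by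
  have hx := hasDerivAt_id' x
  have hp := hasDerivAt_one_sub_sq x
  refine HasDerivAt.congr_deriv
    ((((((hp.fun_pow 4).fun_mul (((((h₀.fun_pow 2).fun_mul h₄).fun_sub
      ((h₀.fun_mul (h₁.fun_mul h₃)).const_mul 2)).fun_add (h₀.fun_mul (h₂.fun_pow 2))).fun_sub
      (((h₁.fun_pow 2).fun_mul h₂).const_mul (1 / 2)))).fun_add
    ((hx.fun_mul (hp.fun_pow 3)).fun_mul (((((h₀.fun_pow 2).fun_mul h₃).const_mul (-12)).fun_add
      ((h₀.fun_mul (h₁.fun_mul h₂)).const_mul 8)).fun_add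
      ((h₁.fun_pow 3).const_mul (8 / 3))))).fun_add
    ((hp.fun_pow 2).fun_mul (((((hx.fun_pow 2).const_mul 36).sub_const 28).fun_mul
      ((h₀.fun_pow 2).fun_mul h₂)).fun_add ((((hx.fun_pow 2).const_mul 8).const_sub 24).fun_mul
      (h₀.fun_mul (h₁.fun_pow 2)))))).fun_add
    ((hp.fun_mul ((hx.const_mul 56).fun_sub ((hx.fun_pow 3).const_mul 24))).fun_mul
      ((h₀.fun_pow 2).fun_mul h₁))).fun_add ((h₀.fun_pow 3).const_mul (64 / 3))) ?_
  norm_num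
  ring

/-- `∫ x g g⁽⁵⁾ = -(5/2) ∫ g''²` up to a boundary term. -/
theorem hasDerivAt_quadratic_boundary_term {g₀ g₁ g₂ g₃ g₄ : ℝ → ℝ} {g₅ : ℝ} (x : ℝ)
    (h₀ : HasDerivAt g₀ (g₁ x) x) (h₁ : HasDerivAt g₁ (g₂ x) x) (h₂ : HasDerivAt g₂ (g₃ x) x)
    (h₃ : HasDerivAt g₃ (g₄ x) x) (h₄ : HasDerivAt g₄ g₅ x) :
    HasDerivAt (fun y => y * (g₀ y * g₄ y) - g₀ y * g₃ y - y * (g₁ y * g₃ y)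
      + 2 * (g₁ y * g₂ y) + 1 / 2 * (y * g₂ y ^ 2))
    (x * g₀ x * g₅ + 5 / 2 * g₂ x ^ 2) x := by
  have hx := hasDerivAt_id' x
  refine HasDerivAt.congr_deriv
    (((((hx.fun_mul (h₀.fun_mul h₄)).fun_sub (h₀.fun_mul h₃)).fun_sub
      (hx.fun_mul (h₁.fun_mul h₃))).fun_add ((h₁.fun_mul h₂).const_mul 2)).fun_add
      ((hx.fun_mul (h₂.fun_pow 2)).const_mul (1 / 2))) ?_
  norm_num
  ring

/-- For `b ∈ {10, 12}` the operator `G ↦ [(1 - x²)² G]⁽⁵⁾` factors through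
`M = (1 - x²) G''' - 8 x G'' - b G'`, and the minimum principle applies to `M`. -/
theorem neg_mul_le_of_weighted_fifth_deriv_le {G : ℝ → ℝ} (hG : ContDiff ℝ 6 G) {b K : ℝ}
    (hb : b = 10 ∨ b = 12)
    (hK : ∀ x ∈ Icc (-1 : ℝ) 1, (1 - x ^ 2) ^ 2 * iteratedDeriv 5 G x
      - 20 * x * (1 - x ^ 2) * iteratedDeriv 4 G x + 40 * (3 * x ^ 2 - 1) * iteratedDeriv 3 G x
      + 240 * x * iteratedDeriv 2 G x + 120 * iteratedDeriv 1 G x ≤ K)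
    {x : ℝ} (hx : x ∈ Icc (-1 : ℝ) 1) :
    (22 - b) * -((1 - x ^ 2) * iteratedDeriv 3 G x - 8 * x * iteratedDeriv 2 G x
      - b * iteratedDeriv 1 G x) ≤ K := by
  have h := fun {k : ℕ} (hk : k < 6) (x : ℝ) =>
    ContDiff.hasDerivAt_iteratedDeriv (n := 6) (f := G) hG hk x
  refine neg_le_of_degenerate_elliptic_le
    (M := fun x => (1 - x ^ 2) * iteratedDeriv 3 G x - 8 * x * iteratedDeriv 2 G x
      - b * iteratedDeriv 1 G x)
    (M₁ := fun x => (1 - x ^ 2) * iteratedDeriv 4 G x - 10 * x * iteratedDeriv 3 G x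
      - (8 + b) * iteratedDeriv 2 G x)
    (M₂ := fun x => (1 - x ^ 2) * iteratedDeriv 5 G x - 12 * x * iteratedDeriv 4 G x
      - (18 + b) * iteratedDeriv 3 G x) (fun x => ?_) (fun x => ?_)
    (by rcases hb with rfl | rfl <;> norm_num) (fun x hx => ?_) hx
  · refine ((((hasDerivAt_one_sub_sq x).fun_mul (h (k := 3) (by norm_num) x)).fun_sub
      (((hasDerivAt_id' x).const_mul 8).fun_mul (h (k := 2) (by norm_num) x))).fun_sub
      ((h (k := 1) (by norm_num) x).const_mul b)).congr_deriv ?_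
    ring
  · refine ((((hasDerivAt_one_sub_sq x).fun_mul (h (k := 4) (by norm_num) x)).fun_sub
      (((hasDerivAt_id' x).const_mul 10).fun_mul (h (k := 3) (by norm_num) x))).fun_sub
      ((h (k := 2) (by norm_num) x).const_mul (8 + b))).congr_deriv ?_
    ring
  · refine le_of_eq_of_le ?_ (hK x hx)
    rcases hb with rfl | rfl <;> ring

/-! ### The inequality -/

theorem iteratedDeriv_eq_of_hasDerivAt {f : ℕ → ℝ → ℝ} {n : ℕ}
    (h : ∀ k < n, ∀ x, HasDerivAt (f k) (f (k + 1) x) x) {k : ℕ} (hk : k ≤ n) :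
    iteratedDeriv k (f 0) = f k := by
  induction k with
  | zero => exact iteratedDeriv_zero
  | succ k ih =>
    rw [iteratedDeriv_succ, ih (by omega)]
    exact funext fun x => (h k (by omega) x).deriv

section SmoothProfile

variable {G : ℝ → ℝ}

/-- The Leibniz formula for `(1 - x²)² G`, in the orders that occur below. -/
theorem iteratedDeriv_weight_mul (hG : ContDiff ℝ 8 G) (x : ℝ) :
    iteratedDeriv 1 (fun y => (1 - y ^ 2) ^ 2 * G y) x =
      (1 - x ^ 2) ^ 2 * iteratedDeriv 1 G x - 4 * x * (1 - x ^ 2) * G x ∧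
    iteratedDeriv 2 (fun y => (1 - y ^ 2) ^ 2 * G y) x =
      (1 - x ^ 2) ^ 2 * iteratedDeriv 2 G x - 8 * x * (1 - x ^ 2) * iteratedDeriv 1 G x
        + (12 * x ^ 2 - 4) * G x ∧
    iteratedDeriv 5 (fun y => (1 - y ^ 2) ^ 2 * G y) x =
      (1 - x ^ 2) ^ 2 * iteratedDeriv 5 G x - 20 * x * (1 - x ^ 2) * iteratedDeriv 4 G x
        + 40 * (3 * x ^ 2 - 1) * iteratedDeriv 3 G x + 240 * x * iteratedDeriv 2 G x
        + 120 * iteratedDeriv 1 G x := by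
  let f : ℕ → ℝ → ℝ
    | 0 => fun y => (1 - y ^ 2) ^ 2 * G y
    | 1 => fun y => (1 - y ^ 2) ^ 2 * iteratedDeriv 1 G y - 4 * y * (1 - y ^ 2) * G y
    | 2 => fun y => (1 - y ^ 2) ^ 2 * iteratedDeriv 2 G y
        - 8 * y * (1 - y ^ 2) * iteratedDeriv 1 G y + (12 * y ^ 2 - 4) * G y
    | 3 => fun y => (1 - y ^ 2) ^ 2 * iteratedDeriv 3 G y
        - 12 * y * (1 - y ^ 2) * iteratedDeriv 2 G y
        + (36 * y ^ 2 - 12) * iteratedDeriv 1 G y + 24 * y * G y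
    | 4 => fun y => (1 - y ^ 2) ^ 2 * iteratedDeriv 4 G y
        - 16 * y * (1 - y ^ 2) * iteratedDeriv 3 G y
        + (72 * y ^ 2 - 24) * iteratedDeriv 2 G y + 96 * y * iteratedDeriv 1 G y + 24 * G y
    | _ => fun y => (1 - y ^ 2) ^ 2 * iteratedDeriv 5 G y
        - 20 * y * (1 - y ^ 2) * iteratedDeriv 4 G y
        + 40 * (3 * y ^ 2 - 1) * iteratedDeriv 3 G y + 240 * y * iteratedDeriv 2 G y
        + 120 * iteratedDeriv 1 G y
  have hf : ∀ k < 5, ∀ x, HasDerivAt (f k) (f (k + 1) x) x := fun k hk x => by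
    have h := fun {k : ℕ} (hk : k < 8) =>
      ContDiff.hasDerivAt_iteratedDeriv (n := 8) (f := G) hG hk x
    have h0 : HasDerivAt G (iteratedDeriv 1 G x) x := by simpa using h (k := 0) (by norm_num)
    have h1 := h (k := 1) (by norm_num)
    have h2 := h (k := 2) (by norm_num)
    have h3 := h (k := 3) (by norm_num)
    have h4 := h (k := 4) (by norm_num)
    have hx := hasDerivAt_id' x
    have hp := hasDerivAt_one_sub_sq x
    have hq := fun c : ℝ => (hx.const_mul c).fun_mul hp
    have hs := fun c d : ℝ => ((hx.fun_pow 2).const_mul c).sub_const d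
    interval_cases k
    · refine ((hp.fun_pow 2).fun_mul h0).congr_deriv ?_
      simp only [f]; norm_num; ring
    · refine (((hp.fun_pow 2).fun_mul h1).fun_sub ((hq 4).fun_mul h0)).congr_deriv ?_
      simp only [f]; norm_num; ring
    · refine ((((hp.fun_pow 2).fun_mul h2).fun_sub ((hq 8).fun_mul h1)).fun_add
        ((hs 12 4).fun_mul h0)).congr_deriv ?_
      simp only [f]; norm_num; ring
    · refine (((((hp.fun_pow 2).fun_mul h3).fun_sub ((hq 12).fun_mul h2)).fun_add
        ((hs 36 12).fun_mul h1)).fun_add ((hx.const_mul 24).fun_mul h0)).congr_deriv ?_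
      simp only [f]; norm_num; ring
    · refine ((((((hp.fun_pow 2).fun_mul h4).fun_sub ((hq 16).fun_mul h3)).fun_add
        ((hs 72 24).fun_mul h2)).fun_add ((hx.const_mul 96).fun_mul h1)).fun_add
        (h0.const_mul 24)).congr_deriv ?_
      simp only [f]; norm_num; ring
  exact ⟨congrFun (iteratedDeriv_eq_of_hasDerivAt hf (k := 1) (by norm_num)) x,
    congrFun (iteratedDeriv_eq_of_hasDerivAt hf (k := 2) (by norm_num)) x,
    congrFun (iteratedDeriv_eq_of_hasDerivAt hf (k := 5) le_rfl) x⟩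

/-- With `g = (1 - x²)² G` one has `[(1 - x²)³ G']⁽⁵⁾ = (1 - x²) g⁽⁶⁾ - 6 x g⁽⁵⁾`. -/
theorem iteratedDeriv_five_weight_mul_deriv (hG : ContDiff ℝ 8 G) (x : ℝ) :
    iteratedDeriv 5 (fun y => (1 - y ^ 2) ^ 3 * deriv G y) x =
      (1 - x ^ 2) * iteratedDeriv 6 (fun y => (1 - y ^ 2) ^ 2 * G y) x
        - 6 * x * iteratedDeriv 5 (fun y => (1 - y ^ 2) ^ 2 * G y) x := by
  set g : ℝ → ℝ := fun y => (1 - y ^ 2) ^ 2 * G y with hg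
  have hgc : ContDiff ℝ 8 g := by fun_prop
  let f : ℕ → ℝ → ℝ
    | 0 => fun y => (1 - y ^ 2) * iteratedDeriv 1 g y + 4 * y * iteratedDeriv 0 g y
    | 1 => fun y => (1 - y ^ 2) * iteratedDeriv 2 g y + 2 * y * iteratedDeriv 1 g y
        + 4 * iteratedDeriv 0 g y
    | 2 => fun y => (1 - y ^ 2) * iteratedDeriv 3 g y + 0 * y * iteratedDeriv 2 g y
        + 6 * iteratedDeriv 1 g y
    | 3 => fun y => (1 - y ^ 2) * iteratedDeriv 4 g y + -2 * y * iteratedDeriv 3 g y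
        + 6 * iteratedDeriv 2 g y
    | 4 => fun y => (1 - y ^ 2) * iteratedDeriv 5 g y + -4 * y * iteratedDeriv 4 g y
        + 4 * iteratedDeriv 3 g y
    | _ => fun y => (1 - y ^ 2) * iteratedDeriv 6 g y - 6 * y * iteratedDeriv 5 g y
  have hf : ∀ k < 5, ∀ x, HasDerivAt (f k) (f (k + 1) x) x := fun k hk x => by
    have h := fun {k : ℕ} (hk : k < 8) =>
      ContDiff.hasDerivAt_iteratedDeriv (n := 8) (f := g) hgc hk x
    have hp := hasDerivAt_one_sub_sq x
    have hm := fun (k : ℕ) (hk : k < 7) (c : ℝ) =>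
      (hp.fun_mul (h (k := k + 1) (by omega))).fun_add
        (((hasDerivAt_id' x).const_mul c).fun_mul (h (k := k) (by omega)))
    interval_cases k
    · refine (hm 0 (by norm_num) 4).congr_deriv ?_
      simp only [f]; ring
    · refine ((hm 1 (by norm_num) 2).fun_add
        ((h (k := 0) (by norm_num)).const_mul 4)).congr_deriv ?_
      simp only [f]; ring
    · refine ((hm 2 (by norm_num) 0).fun_add
        ((h (k := 1) (by norm_num)).const_mul 6)).congr_deriv ?_
      simp only [f]; ring
    · refine ((hm 3 (by norm_num) (-2)).fun_add
        ((h (k := 2) (by norm_num)).const_mul 6)).congr_deriv ?_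
      simp only [f]; ring
    · refine ((hm 4 (by norm_num) (-4)).fun_add
        ((h (k := 3) (by norm_num)).const_mul 4)).congr_deriv ?_
      simp only [f]; ring
  have h0 : (fun y => (1 - y ^ 2) ^ 3 * deriv G y) = f 0 := by
    funext y
    have h1 := (iteratedDeriv_weight_mul hG y).1
    rw [← hg, iteratedDeriv_one (f := G)] at h1
    simp only [f, h1, iteratedDeriv_zero]
    simp only [hg]
    ring
  rw [h0]
  exact congrFun (iteratedDeriv_eq_of_hasDerivAt hf le_rfl) x

theorem continuous_floorIntegrand (hG : ContDiff ℝ 8 G) : Continuous (floorIntegrand G) := by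
  have hg : ContDiff ℝ 8 fun y => (1 - y ^ 2) ^ 2 * G y := by fun_prop
  have h5 := hg.continuous_iteratedDeriv 5 (by norm_num)
  have h6 := hg.continuous_iteratedDeriv 6 (by norm_num)
  have hc := hG.continuous
  have : floorIntegrand G = fun x => (1 - x ^ 2) ^ 2 *
      ((1 - x ^ 2) * iteratedDeriv 6 (fun y => (1 - y ^ 2) ^ 2 * G y) x
        - 6 * x * iteratedDeriv 5 (fun y => (1 - y ^ 2) ^ 2 * G y) x) * G x :=
    funext fun x => by rw [floorIntegrand, iteratedDeriv_five_weight_mul_deriv hG]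
  rw [this]
  fun_prop

/-- The form `∫ (1 - x²)² G (x - G) [(1 - x²)² G]⁽⁵⁾`, integrated by parts. -/
theorem integral_linear_sub_cubic_eq_zero (hG : ContDiff ℝ 8 G) (hm : G (-1) = 0)
    (hp : G 1 = 0) {g : ℝ → ℝ} (hg : g = fun y => (1 - y ^ 2) ^ 2 * G y) :
    ∫ x in (-1 : ℝ)..1, ((x * g x * iteratedDeriv 5 g x + 5 / 2 * iteratedDeriv 2 g x ^ 2)
      - ((1 - x ^ 2) ^ 2 * G x ^ 2 * iteratedDeriv 5 g x
        - 5 / 2 * ((1 - x ^ 2) ^ 3 * iteratedDeriv 1 G x ^ 2 * ((1 - x ^ 2) * iteratedDeriv 3 G x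
          - 8 * x * iteratedDeriv 2 G x - 32 / 3 * iteratedDeriv 1 G x)))) = 0 := by
  have hgc : ContDiff ℝ 8 g := by rw [hg]; fun_prop
  have hl := iteratedDeriv_weight_mul hG
  rw [← hg] at hl
  have hG' := fun {k : ℕ} (hk : k < 8) (x : ℝ) =>
    ContDiff.hasDerivAt_iteratedDeriv (n := 8) (f := G) hG hk x
  have hg' := fun {k : ℕ} (hk : k < 8) (x : ℝ) =>
    ContDiff.hasDerivAt_iteratedDeriv (n := 8) (f := g) hgc hk x
  have hG0 : ∀ x, HasDerivAt G (iteratedDeriv 1 G x) x := fun x => by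
    simpa using hG' (k := 0) (by norm_num) x
  have hg0 : ∀ x, HasDerivAt g (iteratedDeriv 1 g x) x := fun x => by
    simpa using hg' (k := 0) (by norm_num) x
  have hd := fun x (_ : x ∈ uIcc (-1 : ℝ) 1) =>
    (hasDerivAt_quadratic_boundary_term x (hg0 x) (hg' (k := 1) (by norm_num) x)
      (hg' (k := 2) (by norm_num) x) (hg' (k := 3) (by norm_num) x)
      (hg' (k := 4) (by norm_num) x)).fun_sub
    (hasDerivAt_cubic_boundary_term x (hG0 x) (hG' (k := 1) (by norm_num) x)
      (hG' (k := 2) (by norm_num) x) (hG' (k := 3) (by norm_num) x)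
      (hG' (k := 4) (by norm_num) x))
  simp only [Nat.reduceAdd, ← (hl _).2.2] at hd
  have hcG := hG.continuous
  have hcg := hgc.continuous
  have hG1 := hG.continuous_iteratedDeriv 1 (by norm_num)
  have hG2 := hG.continuous_iteratedDeriv 2 (by norm_num)
  have hG3 := hG.continuous_iteratedDeriv 3 (by norm_num)
  have hg2 := hgc.continuous_iteratedDeriv 2 (by norm_num)
  have hg5 := hgc.continuous_iteratedDeriv 5 (by norm_num)
  rw [intervalIntegral.integral_eq_sub_of_hasDerivAt hd
    (Continuous.intervalIntegrable (by fun_prop) _ _)]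
  have e1 : g 1 = 0 := by rw [hg]; norm_num
  have e2 : g (-1) = 0 := by rw [hg]; norm_num
  simp only [(hl _).1, (hl _).2.1, e1, e2, hm, hp]
  norm_num

/-- The inequality for a function smooth up to the poles, from the two facts about
`g = (1 - x²)² G` that the equation provides. -/
theorem floorSq_le_of_contDiff (hG : ContDiff ℝ 8 G) (hm : G (-1) = 0) (hp : G 1 = 0)
    {α : ℝ} {g : ℝ → ℝ} (hg : g = fun y => (1 - y ^ 2) ^ 2 * G y)
    (h5 : ∀ x ∈ Ioo (-1 : ℝ) 1, iteratedDeriv 5 g x ≤ 120 / α)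
    (h6 : ∀ x ∈ Ioo (-1 : ℝ) 1,
      (1 - x ^ 2) * iteratedDeriv 6 g x = 6 * G x * (iteratedDeriv 5 g x - 120 / α)) :
    floorSq G ≤ -15 * (∫ x in (-1 : ℝ)..1, |iteratedDeriv 2 g x| ^ 2)
      + 720 / α * (∫ x in (-1 : ℝ)..1, (1 - x ^ 2) ^ 2 * G x ^ 2)
      + 160 / α * (∫ x in (-1 : ℝ)..1, (1 - x ^ 2) ^ 3 * deriv G x ^ 2) := by
  have hgc : ContDiff ℝ 8 g := by rw [hg]; fun_prop
  have hcG := hG.continuous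
  have hcg := hgc.continuous
  have hdG : Continuous (deriv G) := hG.continuous_deriv (by norm_num)
  have hG1 := hG.continuous_iteratedDeriv 1 (by norm_num)
  have hG2 := hG.continuous_iteratedDeriv 2 (by norm_num)
  have hG3 := hG.continuous_iteratedDeriv 3 (by norm_num)
  have hg2 := hgc.continuous_iteratedDeriv 2 (by norm_num)
  have hg5 := hgc.continuous_iteratedDeriv 5 (by norm_num)
  have hl := fun x => (iteratedDeriv_weight_mul hG x).2.2
  rw [← hg] at hl
  have h5' : ∀ x ∈ Icc (-1 : ℝ) 1, iteratedDeriv 5 g x ≤ 120 / α := fun x hx =>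
    le_on_closure h5 hg5.continuousOn continuousOn_const
      (by rwa [closure_Ioo (by norm_num)])
  have hM := fun {b : ℝ} (hb : b = 10 ∨ b = 12) {x : ℝ} (hx : x ∈ Icc (-1 : ℝ) 1) =>
    neg_mul_le_of_weighted_fifth_deriv_le (hG.of_le (by norm_num)) hb
      (fun y hy => (hl y).symm.trans_le (h5' y hy)) hx
  let D : ℝ → ℝ := fun x =>
    (x * g x * iteratedDeriv 5 g x + 5 / 2 * iteratedDeriv 2 g x ^ 2)
      - ((1 - x ^ 2) ^ 2 * G x ^ 2 * iteratedDeriv 5 g x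
        - 5 / 2 * ((1 - x ^ 2) ^ 3 * iteratedDeriv 1 G x ^ 2 * ((1 - x ^ 2) * iteratedDeriv 3 G x
          - 8 * x * iteratedDeriv 2 G x - 32 / 3 * iteratedDeriv 1 G x)))
  have hD : ∫ x in (-1 : ℝ)..1, D x = 0 := integral_linear_sub_cubic_eq_zero hG hm hp hg
  have hDc : Continuous D := by fun_prop
  have hpt : ∀ x ∈ Ioo (-1 : ℝ) 1, -floorIntegrand G x ≤
      -15 * |iteratedDeriv 2 g x| ^ 2 + 720 / α * ((1 - x ^ 2) ^ 2 * G x ^ 2)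
        + 160 / α * ((1 - x ^ 2) ^ 3 * deriv G x ^ 2) + 6 * D x := fun x hx => by
    have hM10 := hM (Or.inl rfl) (Ioo_subset_Icc_self hx)
    have hM12 := hM (Or.inr rfl) (Ioo_subset_Icc_self hx)
    -- `32/3 = (2/3) * 10 + (1/3) * 12`, so the two bounds combine to `-M ≤ 32 / (3 α)`.
    have hMx : 0 ≤ 160 / α + 15 * ((1 - x ^ 2) * iteratedDeriv 3 G x
        - 8 * x * iteratedDeriv 2 G x - 32 / 3 * iteratedDeriv 1 G x) := by
      rw [show (160 : ℝ) / α = 4 / 3 * (120 / α) by ring]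
      linarith
    have hpx : 0 ≤ 1 - x ^ 2 := by nlinarith [hx.1, hx.2]
    have hnn := mul_nonneg (mul_nonneg (pow_nonneg hpx 3) (sq_nonneg (iteratedDeriv 1 G x))) hMx
    have hfl : -floorIntegrand G x = -(g x * ((1 - x ^ 2) * iteratedDeriv 6 g x))
        + 6 * (x * g x * iteratedDeriv 5 g x) := by
      rw [floorIntegrand, iteratedDeriv_five_weight_mul_deriv hG, ← hg,
        show g x = (1 - x ^ 2) ^ 2 * G x from congrFun hg x]
      ring
    have hgG : g x * (6 * G x * (iteratedDeriv 5 g x - 120 / α)) =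
        6 * ((1 - x ^ 2) ^ 2 * G x ^ 2 * iteratedDeriv 5 g x)
          - 720 / α * ((1 - x ^ 2) ^ 2 * G x ^ 2) := by
      rw [show g x = (1 - x ^ 2) ^ 2 * G x from congrFun hg x]
      ring
    rw [hfl, h6 x hx, hgG, sq_abs, ← iteratedDeriv_one]
    simp only [D]
    linarith
  have hint : ∀ {f : ℝ → ℝ}, Continuous f → IntervalIntegrable f volume (-1) 1 :=
    fun hf => hf.intervalIntegrable _ _
  have hmono := intervalIntegral.integral_mono_on_of_le_Ioo (by norm_num)
    (hint (continuous_floorIntegrand hG).neg) (hint (by fun_prop)) hpt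
  rw [intervalIntegral.integral_add (hint (by fun_prop)) (hint (by fun_prop)),
    intervalIntegral.integral_add (hint (by fun_prop)) (hint (by fun_prop)),
    intervalIntegral.integral_add (hint (by fun_prop)) (hint (by fun_prop))] at hmono
  simp only [intervalIntegral.integral_const_mul, hD, mul_zero, add_zero] at hmono
  rwa [floorSq, ← intervalIntegral.integral_neg]

end SmoothProfile

theorem proposition3p1 (α : ℝ) (hα : 0 < α) (u : ℝ → ℝ) (hu : IsAxialSolution α u)
    (G : ℝ → ℝ) (hG : G = axialG u) :
    IntervalIntegrable (floorIntegrand G) volume (-1) 1 ∧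
    IntervalIntegrable
      (fun x : ℝ => |iteratedDeriv 2 (fun y : ℝ => (1 - y ^ 2) ^ 2 * G y) x| ^ 2) volume (-1) 1 ∧
    IntervalIntegrable (fun x : ℝ => (1 - x ^ 2) ^ 2 * G x ^ 2) volume (-1) 1 ∧
    IntervalIntegrable (fun x : ℝ => (1 - x ^ 2) ^ 3 * deriv G x ^ 2) volume (-1) 1 ∧
    floorSq G ≤
      -15 * (∫ x in (-1 : ℝ)..1, |iteratedDeriv 2 (fun y : ℝ => (1 - y ^ 2) ^ 2 * G y) x| ^ 2)
      + 720 / α * (∫ x in (-1 : ℝ)..1, (1 - x ^ 2) ^ 2 * G x ^ 2)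
      + 160 / α * (∫ x in (-1 : ℝ)..1, (1 - x ^ 2) ^ 3 * deriv G x ^ 2) := by
  obtain ⟨w, hw, hwu⟩ := hu.exists_contDiff_extension hα
  have hdw : ContDiff ℝ 8 (deriv w) := (contDiff_succ_iff_deriv (n := 8)).1 hw |>.2.2
  let W : ℝ → ℝ := fun x => (1 - x ^ 2) * deriv w x
  let g : ℝ → ℝ := fun y => (1 - y ^ 2) ^ 2 * W y
  have hW : ContDiff ℝ 8 W := by fun_prop
  have hg : ContDiff ℝ 8 g := by fun_prop
  have hwu' : EqOn (deriv w) (deriv u) (Ioo (-1) 1) :=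
    (hwu.mono Ioo_subset_Icc_self).deriv isOpen_Ioo
  have hGW : EqOn G W (Ioo (-1) 1) := fun x hx => by simp only [hG, axialG, W, hwu' hx]
  have hdGW : EqOn (deriv G) (deriv W) (Ioo (-1) 1) := hGW.deriv isOpen_Ioo
  -- The two functions differ at most at the poles, which the integrals do not see.
  have e1 : EqOn (floorIntegrand G) (floorIntegrand W) (Ioo (-1) 1) := fun x hx => by
    have h : EqOn (fun y : ℝ => (1 - y ^ 2) ^ 3 * deriv G y)
        (fun y : ℝ => (1 - y ^ 2) ^ 3 * deriv W y) (Ioo (-1) 1) := fun y hy => by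
      simp only [hdGW hy]
    simp only [floorIntegrand, hGW hx, h.iteratedDeriv_of_isOpen isOpen_Ioo 5 hx]
  have e2 : EqOn (fun x : ℝ => |iteratedDeriv 2 (fun y : ℝ => (1 - y ^ 2) ^ 2 * G y) x| ^ 2)
      (fun x => |iteratedDeriv 2 g x| ^ 2) (Ioo (-1) 1) := fun x hx => by
    have h : EqOn (fun y : ℝ => (1 - y ^ 2) ^ 2 * G y) g (Ioo (-1) 1) := fun y hy => by
      simp only [g, hGW hy]
    simp only [h.iteratedDeriv_of_isOpen isOpen_Ioo 2 hx]
  have e3 : EqOn (fun x : ℝ => (1 - x ^ 2) ^ 2 * G x ^ 2)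
      (fun x => (1 - x ^ 2) ^ 2 * W x ^ 2) (Ioo (-1) 1) := fun x hx => by simp only [hGW hx]
  have e4 : EqOn (fun x : ℝ => (1 - x ^ 2) ^ 3 * deriv G x ^ 2)
      (fun x => (1 - x ^ 2) ^ 3 * deriv W x ^ 2) (Ioo (-1) 1) := fun x hx => by
    simp only [hdGW hx]
  have hint : ∀ {f k : ℝ → ℝ}, EqOn f k (Ioo (-1) 1) → Continuous k →
      IntervalIntegrable f volume (-1) 1 := fun hfk hk =>
    (hk.intervalIntegrable _ _).congr_uIoo (by rw [uIoo_of_le (by norm_num)]; exact hfk.symm)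
  have hWc := hW.continuous
  have hdW : Continuous (deriv W) := hW.continuous_deriv (by norm_num)
  have hg2 := hg.continuous_iteratedDeriv 2 (by norm_num)
  have hg5 : EqOn (iteratedDeriv 5 g)
      (fun x => 120 / α + -128 / (gammaConst u * α) * Real.exp (6 * w x)) (Ioo (-1) 1) :=
    fun x hx => by
      have h : EqOn g (fun y : ℝ => (1 - y ^ 2) ^ 3 * deriv u y) (Ioo (-1) 1) := fun y hy => by
        simp only [g, W, hwu' hy]
        ring
      rw [h.iteratedDeriv_of_isOpen isOpen_Ioo 5 hx, hu.iteratedDeriv_five_eq hα hx,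
        ← hwu (Ioo_subset_Icc_self hx)]
  have hγ : 0 ≤ gammaConst u :=
    intervalIntegral.integral_nonneg (by norm_num) fun x _ => by positivity
  refine ⟨hint e1 (continuous_floorIntegrand hW), hint e2 (by fun_prop), hint e3 (by fun_prop),
    hint e4 (by fun_prop), ?_⟩
  rw [floorSq, intervalIntegral.integral_congr_Ioo_of_le (by norm_num) e1,
    intervalIntegral.integral_congr_Ioo_of_le (by norm_num) e2,
    intervalIntegral.integral_congr_Ioo_of_le (by norm_num) e3,
    intervalIntegral.integral_congr_Ioo_of_le (by norm_num) e4, ← floorSq]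
  refine floorSq_le_of_contDiff hW (by simp [W]) (by simp [W]) rfl (fun x hx => ?_)
    fun x hx => ?_
  · have h : 0 ≤ 128 / (gammaConst u * α) * Real.exp (6 * w x) := by positivity
    have := hg5 hx
    simp only [neg_div, neg_mul] at this
    linarith
  · have hw' := (((hw.differentiable (by norm_num)) x).hasDerivAt.const_mul 6).exp.const_mul
      (-128 / (gammaConst u * α)) |>.const_add (120 / α)
    rw [iteratedDeriv_succ, hg5.deriv isOpen_Ioo hx, hw'.deriv, hg5 hx]
    simp only [W]
    ring
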